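/- Let $\Omega$ be a finite set of cardinality $d \ge 3$, let $\mathcal{T}_d$ be the $d$-regular tree, and fix a colouring $c$ of its (non-oriented) edges by elements of $\Omega$ such that for every vertex $v$ the map $c$ restricts to a bijection $c_v : E(v) \to \Omega$ on the set $E(v)$ of edges containing $v$. For $g \in \mathrm{Aut}(\mathcal{T}_d)$ and a vertex $v$, let $g_v : E(v) \to E(gv)$ be the bijection induced by $g$, and let $\sigma(g,v) = c_{gv} \circ g_v \circ c_v^{-1} \in \mathrm{Sym}(\Omega)$ be the local permutation of $g$ at $v$. For subgroups $F \le F' \le \mathrm{Sym}(\Omega)$ let $G(F,F')$ be the group of all $g \in \mathrm{Aut}(\mathcal{T}_d)$ such that $\sigma(g,v) \in F'$ for every vertex $v$ and $\sigma(g,v) \in F$ for all but finitely many vertices $v$. Let $G(F,F')^\star$ be its type-preserving subgroup, i.e. the subgroup of those elements that map each block of the natural bipartition of the vertex set to itself (two vertices lie in the same block if they are at even distance). For $a \in \Omega$ write $F_a$ and $F'_a$ for the stabilizers of $a$ in $F$ and $F'$. Suppose that $F$ is transitive on $\Omega$ and that $F'$ is generated by the derived subgroups of its point stabilizers together with the point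 stabilizers of $F$, that is, $F' = \langle\, [F'_a, F'_a] \cup F_a : a \in \Omega \,\rangle$. Then $G(F,F')^\star$ has index two in $G(F,F')$, and it is a simple group. -/

import Mathlib

namespace TreeLocalAction

variable {V Ω : Type*} {T : SimpleGraph V}

/-- A colouring of the (non-oriented) edges of `T` by `Ω` that restricts, for every vertex `v`, to a
bijection from the set of edges containing `v` onto `Ω`. In particular, every vertex of `T` has
exactly `|Ω|` neighbours, so that a tree with such a colouring is the regular tree of degree
`|Ω|`. -/
structure LegalColoring (T : SimpleGraph V) (Ω : Type*) where
  color : T.edgeSet → Ω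
  bijective : ∀ v : V,
    Function.Bijective (fun e : T.incidenceSet v => color ⟨e.1, T.incidenceSet_subset v e.2⟩)

/-- The bijection `c_v` from the set of edges containing `v` to the set of colours. -/
noncomputable def LegalColoring.star (c : LegalColoring T Ω) (v : V) : T.incidenceSet v ≃ Ω :=
  Equiv.ofBijective _ (c.bijective v)

theorem map_mem_incidenceSet (g : T ≃g T) {v : V} {e : Sym2 V} (he : e ∈ T.incidenceSet v) :
    Sym2.map g e ∈ T.incidenceSet (g v) := by
  obtain ⟨h1, h2⟩ := he
  refine ⟨?_, Sym2.mem_map.2 ⟨v, h2, rfl⟩⟩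
  induction e using Sym2.ind with
  | _ a b => exact g.map_rel_iff.2 h1

/-- The bijection `g_v` from the edges containing `v` to the edges containing `g v` that is induced
by the automorphism `g`. -/
noncomputable def edgeMap (g : T ≃g T) (v : V) : T.incidenceSet v ≃ T.incidenceSet (g v) :=
  Equiv.ofBijective (fun e => ⟨Sym2.map g e.1, map_mem_incidenceSet g e.2⟩) <| by
    constructor
    · intro e e' h
      exact Subtype.ext (Sym2.map.injective g.injective (congrArg Subtype.val h))
    · rintro ⟨e, he⟩
      refine ⟨⟨Sym2.map g.symm e, ?_⟩, ?_⟩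
      · have h := map_mem_incidenceSet g.symm he
        rwa [show g.symm (g v) = v from g.symm_apply_apply v] at h
      · refine Subtype.ext ?_
        induction e using Sym2.ind with
        | _ a b =>
          simp

/-- The local permutation `σ(g, v) = c_{g v} ∘ g_v ∘ c_v⁻¹` of `g` at the vertex `v`. -/
noncomputable def localPerm (c : LegalColoring T Ω) (g : T ≃g T) (v : V) : Equiv.Perm Ω :=
  (c.star v).symm.trans ((edgeMap g v).trans (c.star (g v)))

theorem localPerm_apply_star (c : LegalColoring T Ω) (g : T ≃g T) (v : V)
    (e : T.incidenceSet v) :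
    localPerm c g v (c.star v e) = c.star (g v) (edgeMap g v e) := by
  simp [localPerm]

theorem localPerm_mul (c : LegalColoring T Ω) (g h : T ≃g T) (v : V) :
    localPerm c (g * h) v = localPerm c g (h v) * localPerm c h v := by
  ext x
  obtain ⟨e, rfl⟩ := (c.star v).surjective x
  rw [Equiv.Perm.mul_apply, localPerm_apply_star, localPerm_apply_star, localPerm_apply_star]
  refine congrArg (c.star (g (h v))) (Subtype.ext ?_)
  exact (Sym2.map_map (g := g) (f := h) e.1).symm

theorem localPerm_one (c : LegalColoring T Ω) (v : V) : localPerm c (1 : T ≃g T) v = 1 := by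
  have h := localPerm_mul c (1 : T ≃g T) 1 v
  rw [mul_one] at h
  exact (mul_eq_left.1 h.symm)

theorem localPerm_inv (c : LegalColoring T Ω) (g : T ≃g T) (v : V) :
    localPerm c g⁻¹ v = (localPerm c g (g⁻¹ v))⁻¹ := by
  have h := localPerm_mul c g g⁻¹ v
  rw [mul_inv_cancel, localPerm_one] at h
  exact eq_inv_of_mul_eq_one_right h.symm

/-- The Burger–Mozes group `U(F)`: all local permutations belong to `F`. -/
def U (c : LegalColoring T Ω) (F : Subgroup (Equiv.Perm Ω)) : Subgroup (T ≃g T) where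
  carrier := {g | ∀ v, localPerm c g v ∈ F}
  mul_mem' {g h} hg hh v := by
    rw [localPerm_mul]
    exact F.mul_mem (hg (h v)) (hh v)
  one_mem' v := by
    rw [localPerm_one]
    exact F.one_mem
  inv_mem' {g} hg v := by
    rw [localPerm_inv]
    exact F.inv_mem (hg _)

/-- The group `G(F)`: all but finitely many local permutations belong to `F`. -/
def GSingle (c : LegalColoring T Ω) (F : Subgroup (Equiv.Perm Ω)) : Subgroup (T ≃g T) where
  carrier := {g | {v | localPerm c g v ∉ F}.Finite}
  mul_mem' {g h} hg hh := by
    have hg' : {v | localPerm c g v ∉ F}.Finite := hg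
    have hh' : {v | localPerm c h v ∉ F}.Finite := hh
    refine (hh'.union (hg'.preimage (f := h) h.injective.injOn)).subset ?_
    intro v hv
    by_contra hcon
    simp only [Set.mem_union, Set.mem_preimage, Set.mem_ofPred_eq, not_or, not_not] at hcon
    refine hv ?_
    rw [localPerm_mul]
    exact F.mul_mem hcon.2 hcon.1
  one_mem' := by
    simp [localPerm_one, F.one_mem]
  inv_mem' {g} hg := by
    have hg' : {v | localPerm c g v ∉ F}.Finite := hg
    refine (hg'.preimage (f := ⇑(g⁻¹)) (g⁻¹).injective.injOn).subset ?_
    intro v hv hcon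
    refine hv ?_
    rw [localPerm_inv]
    exact F.inv_mem hcon

/-- The group `G(F, F') = G(F) ∩ U(F')`. -/
def G (c : LegalColoring T Ω) (F F' : Subgroup (Equiv.Perm Ω)) : Subgroup (T ≃g T) :=
  GSingle c F ⊓ U c F'

/-- The automorphisms of `T` that map each block of the natural bipartition of the vertex set to
itself, where the block of a vertex `v` consists of the vertices at even distance from `v`. -/
def typePreserving (T : SimpleGraph V) : Subgroup (T ≃g T) where
  carrier := {g | ∀ v w, Even (T.dist v (g w)) ↔ Even (T.dist v w)}
  mul_mem' {g h} hg hh v w := (hg v (h w)).trans (hh v w)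
  one_mem' _ _ := Iff.rfl
  inv_mem' {g} hg v w := by
    have h := hg v (g⁻¹ w)
    rw [RelIso.apply_inv_self] at h
    exact h.symm

/-- The type-preserving subgroup `H^⋆` of a group `H` of automorphisms of `T`. -/
def typePreservingSubgroup (H : Subgroup (T ≃g T)) : Subgroup H :=
  (typePreserving T).subgroupOf H

/-- The stabilizer `F_a` of the point `a` in the permutation group `F`, as a subgroup of
`Sym(Ω)`. -/
def pointStabilizer (F : Subgroup (Equiv.Perm Ω)) (a : Ω) : Subgroup (Equiv.Perm Ω) :=
  F ⊓ MulAction.stabilizer (Equiv.Perm Ω) a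

end TreeLocalAction

/-! The index is two because a colour-preserving automorphism moves a vertex to a neighbour.

For simplicity, let `N` be a nontrivial subgroup of Aut(T) normalized by G(F,F')^⋆; call a vertex
with local permutation outside `F` a singularity. Since `F` is transitive, conjugating by
automorphisms with constant local permutations in `F` yields, for every half-tree X, an element n of
`N` moving X off itself. If a and b lie in G(F,F')^⋆ and are supported in X, then [[a,n],b] = [a,b],
so [a,b] lies in `N` (`commutator_mem_of_displaces`).

Commutators do not suffice for single elements h of `U c F` supported in a half-tree. Tits' argument
writes h = [k,t] with k the infinite product of the t^n h t^(-n). This k may have infinitely many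
singularities unless t lies in `U c F`, so t must be taken in `N ⊓ U c F`, which is first shown to
be nontrivial (`inf_U_ne_bot`, `mem_of_fixesOff`). Hence every element of `U c F` that fixes an edge
is in `N`.

At a vertex v, elements of F'_a lift to automorphisms supported in a half-tree with no singularity
except possibly v. Commutators of such lifts realise [F'_a,F'_a] in `N`, and lifts of F_a lie in `U
c F`, hence in `N`. The generation hypothesis then makes `N` realise all of `F'` at v
(`le_starAction`). So `N` is transitive on vertices of each type, and a vertex-fixing element of `G
c F F'` is brought into `N` by removing its singularities from the outside inwards
(`mem_of_fixes_vertex`). -/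

namespace TreeLocalAction

variable {V Ω : Type*} {T : SimpleGraph V}

/-! ### Neighbours by colour -/

/-- The neighbour of `v` along the edge of colour `a`. -/
noncomputable def nb (c : LegalColoring T Ω) (v : V) (a : Ω) : V :=
  Sym2.Mem.other ((c.star v).symm a).2.2

theorem edge_nb (c : LegalColoring T Ω) (v : V) (a : Ω) :
    s(v, nb c v a) = ((c.star v).symm a).1 :=
  Sym2.other_spec _

theorem adj_nb (c : LegalColoring T Ω) (v : V) (a : Ω) : T.Adj v (nb c v a) := by
  have h := ((c.star v).symm a).2.1
  rwa [← edge_nb] at h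

theorem star_apply (c : LegalColoring T Ω) (v : V) (e : T.incidenceSet v) :
    c.star v e = c.color ⟨e.1, T.incidenceSet_subset v e.2⟩ := rfl

theorem nb_eq_iff (c : LegalColoring T Ω) {v w : V} (a : Ω) :
    nb c v a = w ↔ ∃ h : T.Adj v w, c.color ⟨s(v, w), h⟩ = a := by
  constructor
  · rintro rfl
    refine ⟨adj_nb c v a, ?_⟩
    have h := (c.star v).apply_symm_apply a
    rw [star_apply] at h
    exact (congrArg c.color (Subtype.ext (edge_nb c v a))).trans h
  · rintro ⟨h, rfl⟩
    have h1 : (c.star v).symm (c.color ⟨s(v, w), h⟩) = ⟨s(v, w), h, Sym2.mem_mk_left v w⟩ := by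
      rw [Equiv.symm_apply_eq, star_apply]
    have h2 := edge_nb c v (c.color ⟨s(v, w), h⟩)
    rw [h1] at h2
    exact Sym2.congr_right.1 h2

theorem nb_nb (c : LegalColoring T Ω) (v : V) (a : Ω) : nb c (nb c v a) a = v := by
  obtain ⟨h, h1⟩ := (nb_eq_iff c a).1 (rfl : nb c v a = nb c v a)
  refine (nb_eq_iff c a).2 ⟨h.symm, ?_⟩
  exact (congrArg c.color (Subtype.ext Sym2.eq_swap)).trans h1

theorem nb_injective (c : LegalColoring T Ω) (v : V) : Function.Injective (nb c v) := by
  intro a b h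
  obtain ⟨_, h1⟩ := (nb_eq_iff c a).1 h
  obtain ⟨_, h2⟩ := (nb_eq_iff c b).1 (rfl : nb c v b = nb c v b)
  exact h1.symm.trans h2

theorem exists_nb_of_adj (c : LegalColoring T Ω) {v w : V} (h : T.Adj v w) : ∃ a, nb c v a = w :=
  ⟨_, (nb_eq_iff c _).2 ⟨h, rfl⟩⟩

/-- This replaces edges by vertices: later arguments use local permutations only through this
identity. -/
theorem map_nb (c : LegalColoring T Ω) (g : T ≃g T) (v : V) (a : Ω) :
    g (nb c v a) = nb c (g v) (localPerm c g v a) := by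
  symm
  refine (nb_eq_iff c _).2 ⟨g.map_rel_iff.2 (adj_nb c v a), ?_⟩
  have h := localPerm_apply_star c g v ((c.star v).symm a)
  rw [Equiv.apply_symm_apply] at h
  rw [h, star_apply]
  congr 1
  refine Subtype.ext ?_
  change _ = Sym2.map g ((c.star v).symm a).1
  rw [← edge_nb]
  rfl

theorem localPerm_eq_of_map_nb (c : LegalColoring T Ω) (g : T ≃g T) (v : V) (s : Equiv.Perm Ω)
    (h : ∀ a, g (nb c v a) = nb c (g v) (s a)) : localPerm c g v = s := by
  ext a
  have := h a
  rw [map_nb] at this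
  exact nb_injective c _ this

theorem nb_induction (hT : T.IsTree) (c : LegalColoring T Ω) {P : V → Prop} (v : V) (hv : P v)
    (h : ∀ w a, P w → P (nb c w a)) (w : V) : P w := by
  obtain ⟨p⟩ := hT.connected v w
  induction p with
  | nil => exact hv
  | @cons u x y hux _ ih =>
    obtain ⟨a, rfl⟩ := exists_nb_of_adj c hux
    exact ih (h _ _ hv)

theorem dist_nb (hT : T.IsTree) (c : LegalColoring T Ω) (v w : V) (a : Ω) :
    T.dist (nb c v a) w = T.dist v w + 1 ∨ T.dist v w = T.dist (nb c v a) w + 1 := by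
  have := hT.dist_eq_dist_add_one_of_adj w (adj_nb c v a)
  rw [T.dist_comm (u := w), T.dist_comm (u := w)] at this
  exact this.symm

/-! ### Half-trees -/

/-- The half-tree of the vertices that are separated from `v` by the edge of colour `a` at `v`. -/
def halfTree (c : LegalColoring T Ω) (v : V) (a : Ω) : Set V :=
  {w | T.dist v w = T.dist (nb c v a) w + 1}

theorem mem_halfTree (c : LegalColoring T Ω) {v w : V} {a : Ω} :
    w ∈ halfTree c v a ↔ T.dist v w = T.dist (nb c v a) w + 1 := Iff.rfl

/-- Distances to the two ends of an edge differ by exactly one. From here on, the complement of a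
half-tree is written as the half-tree seen from the other end. -/
theorem notMem_halfTree (hT : T.IsTree) (c : LegalColoring T Ω) {v w : V} {a : Ω} :
    w ∉ halfTree c v a ↔ w ∈ halfTree c (nb c v a) a := by
  rw [mem_halfTree, mem_halfTree, nb_nb]
  have := dist_nb hT c v w a
  omega

theorem self_notMem_halfTree (c : LegalColoring T Ω) (v : V) (a : Ω) : v ∉ halfTree c v a := by
  simp [mem_halfTree]

theorem nb_mem_halfTree (c : LegalColoring T Ω) (v : V) (a : Ω) : nb c v a ∈ halfTree c v a := by
  rw [mem_halfTree, SimpleGraph.dist_self, SimpleGraph.dist_eq_one_iff_adj.2 (adj_nb c v a)]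

theorem exists_mem_halfTree (hT : T.IsTree) (c : LegalColoring T Ω) {v w : V} (h : w ≠ v) :
    ∃ a, w ∈ halfTree c v a := by
  obtain ⟨p, hp⟩ := hT.connected.exists_walk_length_eq_dist v w
  cases p with
  | nil => exact absurd rfl h
  | @cons _ x _ hvx q =>
    obtain ⟨a, rfl⟩ := exists_nb_of_adj c hvx
    refine ⟨a, ?_⟩
    have h1 := SimpleGraph.dist_le q
    have h2 := dist_nb hT c v w a
    rw [SimpleGraph.Walk.length_cons] at hp
    rw [mem_halfTree]
    omega

/-- Each colour gives a geodesic from `v` to `w` with that first edge, and paths in a tree are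
unique. -/
theorem halfTree_unique (hT : T.IsTree) (c : LegalColoring T Ω) {v w : V} {a b : Ω}
    (ha : w ∈ halfTree c v a) (hb : w ∈ halfTree c v b) : a = b := by
  rw [mem_halfTree] at ha hb
  obtain ⟨p, hp⟩ := hT.connected.exists_walk_length_eq_dist (nb c v a) w
  obtain ⟨q, hq⟩ := hT.connected.exists_walk_length_eq_dist (nb c v b) w
  have hp' := (SimpleGraph.Walk.cons (adj_nb c v a) p).isPath_of_length_eq_dist (by
    rw [SimpleGraph.Walk.length_cons]; omega)
  have hq' := (SimpleGraph.Walk.cons (adj_nb c v b) q).isPath_of_length_eq_dist (by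
    rw [SimpleGraph.Walk.length_cons]; omega)
  have h := congrArg SimpleGraph.Walk.snd ((hT.existsUnique_path v w).unique hp' hq')
  exact nb_injective c v (by simpa using h)

theorem dist_map (hT : T.IsTree) (g : T ≃g T) (v w : V) : T.dist (g v) (g w) = T.dist v w := by
  have key : ∀ (g : T ≃g T) (v w : V), T.dist (g v) (g w) ≤ T.dist v w := by
    intro g v w
    obtain ⟨p, hp⟩ := hT.connected.exists_walk_length_eq_dist v w
    rw [← hp, ← SimpleGraph.Walk.length_map g.toHom p]
    exact SimpleGraph.dist_le _
  refine le_antisymm (key g v w) ?_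
  have := key g.symm (g v) (g w)
  rwa [RelIso.symm_apply_apply, RelIso.symm_apply_apply] at this

theorem map_mem_halfTree (hT : T.IsTree) (c : LegalColoring T Ω) (g : T ≃g T) {v w : V} {a : Ω} :
    g w ∈ halfTree c (g v) (localPerm c g v a) ↔ w ∈ halfTree c v a := by
  rw [mem_halfTree, mem_halfTree, ← map_nb, dist_map hT, dist_map hT]

/-- The only edge that leaves a half-tree is the one that defines it. -/
theorem nb_mem_halfTree_of_mem (hT : T.IsTree) (c : LegalColoring T Ω) {v w : V} {a b : Ω}
    (hw : w ∈ halfTree c v a) (h : nb c w b ∉ halfTree c v a) : w = nb c v a ∧ b = a := by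
  have h1 : w = nb c v a := by
    by_contra hne
    obtain ⟨d, hd⟩ := exists_mem_halfTree hT c hne
    -- Crossing an edge changes every distance by exactly one. The step out of the half-tree must
    -- move away from its root, so it stays in direction `d` as seen from the root.
    have hd' : nb c w b ∈ halfTree c (nb c v a) d := by
      have h1 := (notMem_halfTree hT c).1 h
      have h2 := dist_nb hT c w v b
      have h3 := dist_nb hT c w (nb c v a) b
      have h4 := dist_nb hT c w (nb c (nb c v a) d) b
      have h5 := dist_nb hT c (nb c v a) (nb c w b) d
      rw [mem_halfTree] at *
      rw [nb_nb] at h1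
      simp only [T.dist_comm (u := nb c w b), T.dist_comm (u := w)] at *
      omega
    have := halfTree_unique hT c hd' ((notMem_halfTree hT c).1 h)
    subst this
    exact (notMem_halfTree hT c).2 hd hw
  refine ⟨h1, ?_⟩
  subst h1
  by_contra hb
  have := halfTree_unique hT c (nb_mem_halfTree c (nb c v a) b) ((notMem_halfTree hT c).1 h)
  exact hb this

/-- A half-tree is connected: the geodesic to its root cannot leave it, as the only exit is at the
root. -/
theorem halfTree_induction (hT : T.IsTree) (c : LegalColoring T Ω) {v : V} {a : Ω} {P : V → Prop}
    (h0 : P (nb c v a))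
    (h : ∀ w b, w ∈ halfTree c v a → nb c w b ∈ halfTree c v a → P w → P (nb c w b)) :
    ∀ w ∈ halfTree c v a, P w := by
  suffices ∀ n w, T.dist w (nb c v a) = n → w ∈ halfTree c v a → P w from
    fun w hw => this _ w rfl hw
  intro n
  induction n with
  | zero =>
    intro w hw _
    rw [hT.connected.dist_eq_zero_iff] at hw
    rwa [hw]
  | succ n ih =>
    intro w hn hw
    have hne : nb c v a ≠ w := by
      rintro rfl
      simp at hn
    obtain ⟨b, hb⟩ := exists_mem_halfTree hT c hne
    have hw' : nb c w b ∈ halfTree c v a := by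
      by_contra hcon
      exact hne (nb_mem_halfTree_of_mem hT c hw hcon).1.symm
    rw [mem_halfTree] at hb
    have h2 := h (nb c w b) b hw' (by rwa [nb_nb]) (ih _ (by omega) hw')
    rwa [nb_nb] at h2

/-- The only way out of the larger half-tree is through `v`, which the smaller one avoids. -/
theorem halfTree_subset (hT : T.IsTree) (c : LegalColoring T Ω) {v z : V} {a b : Ω}
    (hz : z ∈ halfTree c v a) (hv : v ∉ halfTree c z b) : halfTree c z b ⊆ halfTree c v a := by
  refine halfTree_induction hT c ?_ ?_
  · by_contra hcon
    obtain ⟨rfl, rfl⟩ := nb_mem_halfTree_of_mem hT c hz hcon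
    apply hv
    simpa [nb_nb] using nb_mem_halfTree c (nb c v b) b
  · intro w e _ hwe hw
    by_contra hcon
    obtain ⟨rfl, rfl⟩ := nb_mem_halfTree_of_mem hT c hw hcon
    rw [nb_nb] at hwe
    exact hv hwe

theorem nb_halfTree_subset (hT : T.IsTree) (c : LegalColoring T Ω) {v : V} {a b : Ω}
    (hab : b ≠ a) : halfTree c (nb c v a) b ⊆ halfTree c v a := by
  intro w hw
  by_contra h
  exact hab (halfTree_unique hT c hw ((notMem_halfTree hT c).1 h))

theorem halfTree_subset_nb (hT : T.IsTree) (c : LegalColoring T Ω) {v : V} {a b : Ω}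
    (hab : a ≠ b) : halfTree c v a ⊆ halfTree c (nb c v b) b := by
  intro w hw
  by_contra h
  rw [notMem_halfTree hT, nb_nb] at h
  exact hab (halfTree_unique hT c hw h)

/-! ### Parity -/

theorem even_dist_iff (hT : T.IsTree) (c : LegalColoring T Ω) (u v w : V) :
    Even (T.dist u w) ↔ (Even (T.dist u v) ↔ Even (T.dist v w)) := by
  refine nb_induction hT c (P := fun u => Even (T.dist u w) ↔
    (Even (T.dist u v) ↔ Even (T.dist v w))) v (by simp) ?_ u
  intro u a ih
  have h1 : Even (T.dist (nb c u a) w) ↔ ¬ Even (T.dist u w) := by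
    rcases dist_nb hT c u w a with h | h <;> simp [h, Nat.even_add_one]
  have h2 : Even (T.dist (nb c u a) v) ↔ ¬ Even (T.dist u v) := by
    rcases dist_nb hT c u v a with h | h <;> simp [h, Nat.even_add_one]
  tauto

theorem mem_typePreserving_iff (hT : T.IsTree) (c : LegalColoring T Ω) (g : T ≃g T) (v : V) :
    g ∈ typePreserving T ↔ Even (T.dist v (g v)) := by
  constructor
  · intro h
    exact (h v v).2 (by simp)
  · intro h x w
    have h1 := even_dist_iff hT c x w (g w)
    have h2 := even_dist_iff hT c w v (g w)
    have h3 := even_dist_iff hT c v (g v) (g w)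
    have h4 := dist_map hT g v w
    rw [T.dist_comm (u := w) (v := v)] at h2
    rw [h4] at h3
    tauto

/-! ### Automorphisms from local data -/

/-- A map built along the geodesics from a base vertex, as a relation: if `v` is sent to `y` then
its neighbours of larger distance to the base vertex are sent to the neighbours of `y` according to
the permutation `τ v y`. -/
inductive StateRel (c : LegalColoring T Ω) (τ : V → V → Equiv.Perm Ω) (v₀ w₀ : V) : V → V → Prop
  | base : StateRel c τ v₀ w₀ v₀ w₀
  | step {v y u : V} (a : Ω) : StateRel c τ v₀ w₀ v y → nb c v a = u →
      T.dist u v₀ = T.dist v v₀ + 1 → StateRel c τ v₀ w₀ u (nb c y (τ v y a))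

/-- A vertex other than `v₀` has exactly one neighbour nearer to `v₀`, so exactly one `step`
determines its image. -/
theorem StateRel.existsUnique (hT : T.IsTree) (c : LegalColoring T Ω) (τ : V → V → Equiv.Perm Ω)
    (v₀ w₀ v : V) : ∃! y, StateRel c τ v₀ w₀ v y := by
  obtain ⟨n, hn⟩ : ∃ n, T.dist v v₀ = n := ⟨_, rfl⟩
  induction n generalizing v with
  | zero =>
    rw [hT.connected.dist_eq_zero_iff] at hn
    subst hn
    refine ⟨w₀, .base, fun y hy => ?_⟩
    cases hy with
    | base => rfl
    | step a _ _ h => simp at h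
  | succ n ih =>
    have hne : v₀ ≠ v := by
      rintro rfl
      simp at hn
    obtain ⟨a, ha⟩ := exists_mem_halfTree hT c hne
    have hd := (mem_halfTree c).1 ha
    obtain ⟨y, hy, huniq⟩ := ih (nb c v a) (by omega)
    refine ⟨_, .step a hy (nb_nb c v a) hd, fun z hz => ?_⟩
    cases hz with
    | base => exact absurd rfl hne
    | @step u y' _ b h1 h2 h3 =>
      subst h2
      have hb : v₀ ∈ halfTree c (nb c u b) b := by rwa [mem_halfTree, nb_nb]
      have := halfTree_unique hT c ha hb
      subst this
      rw [nb_nb] at huniq ⊢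
      rw [huniq y' h1]

/-- Compatibility `hτ` of the data at the two ends of an edge makes the rule valid also towards
`v₀`. The rule may depend on the image vertex so that inverses can be built the same way. -/
theorem exists_map_of_state (hT : T.IsTree) (c : LegalColoring T Ω) (τ : V → V → Equiv.Perm Ω)
    (hτ : ∀ v y a, τ (nb c v a) (nb c y (τ v y a)) a = τ v y a) (v₀ w₀ : V) :
    ∃ f : V → V, f v₀ = w₀ ∧ ∀ v a, f (nb c v a) = nb c (f v) (τ v (f v) a) := by
  choose f hf hu using StateRel.existsUnique hT c τ v₀ w₀
  simp only at hf hu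
  refine ⟨f, (hu v₀ w₀ .base).symm, fun v a => ?_⟩
  rcases dist_nb hT c v v₀ a with h | h
  · exact (hu _ _ (.step a (hf v) rfl h)).symm
  · have h1 := (hu _ _ (.step a (hf (nb c v a)) (nb_nb c v a) h)).symm
    have h2 := hτ (nb c v a) (f (nb c v a)) a
    rw [nb_nb, ← h1] at h2
    rw [h2, h1, nb_nb]

/-- Existence of an automorphism with prescribed compatible local permutations. -/
theorem exists_aut (hT : T.IsTree) (c : LegalColoring T Ω) (s : V → Equiv.Perm Ω)
    (hs : ∀ v a, s (nb c v a) a = s v a) (v₀ w₀ : V) :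
    ∃ g : T ≃g T, g v₀ = w₀ ∧ ∀ v, localPerm c g v = s v := by
  obtain ⟨f, hf0, hf⟩ := exists_map_of_state hT c (fun v _ => s v) (fun v _ a => hs v a) v₀ w₀
  -- The inverse map: at a vertex sent to `y` it must undo the permutation `s y`.
  obtain ⟨k, hk0, hk⟩ := exists_map_of_state hT c (fun _ y => (s y)⁻¹) (fun _ y b => by
    have h := hs y ((s y)⁻¹ b)
    rw [Equiv.Perm.inv_eq_iff_eq, h]
    simp) w₀ v₀
  have hkf : ∀ v, k (f v) = v :=
    nb_induction hT c v₀ (by rw [hf0, hk0]) fun w a hw => by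
      simp [hf, hk, hw]
  have hfk : ∀ v, f (k v) = v :=
    nb_induction hT c w₀ (by rw [hk0, hf0]) fun w a hw => by
      simp [hk, hf, hw]
  have hfadj : ∀ {v w}, T.Adj v w → T.Adj (f v) (f w) := by
    intro v w h
    obtain ⟨a, rfl⟩ := exists_nb_of_adj c h
    rw [hf]
    exact adj_nb c _ _
  have hkadj : ∀ {v w}, T.Adj v w → T.Adj (k v) (k w) := by
    intro v w h
    obtain ⟨a, rfl⟩ := exists_nb_of_adj c h
    rw [hk]
    exact adj_nb c _ _
  refine ⟨⟨⟨f, k, hkf, hfk⟩, fun {v w} => ⟨fun h => ?_, hfadj⟩⟩, hf0, fun v => ?_⟩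
  · have := hkadj h
    simpa [hkf] using this
  · exact localPerm_eq_of_map_nb c _ v _ fun a => hf v a

/-- A map that is given by permutations on the stars of all vertices is an automorphism. -/
theorem exists_aut_of_map (hT : T.IsTree) (c : LegalColoring T Ω) (k : V → V)
    (s : V → Equiv.Perm Ω) (h : ∀ v a, k (nb c v a) = nb c (k v) (s v a)) :
    ∃ g : T ≃g T, (∀ v, g v = k v) ∧ ∀ v, localPerm c g v = s v := by
  have hs : ∀ v a, s (nb c v a) a = s v a := by
    intro v a
    have h1 := h (nb c v a) a
    rw [nb_nb, h v a] at h1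
    apply nb_injective c (nb c (k v) (s v a))
    rw [← h1, nb_nb]
  obtain ⟨v₀⟩ := hT.connected.nonempty
  obtain ⟨g, hg0, hg⟩ := exists_aut hT c s hs v₀ (k v₀)
  refine ⟨g, nb_induction hT c v₀ hg0 fun w a hw => ?_, hg⟩
  rw [map_nb, hg, hw, h]

/-- The automorphism with constant local permutations that sends `v` to `w`. -/
theorem exists_const_aut (hT : T.IsTree) (c : LegalColoring T Ω) (f : Equiv.Perm Ω) (v w : V) :
    ∃ g : T ≃g T, g v = w ∧ ∀ u, localPerm c g u = f :=
  exists_aut hT c (fun _ => f) (fun _ _ => rfl) v w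

theorem U_le_G (c : LegalColoring T Ω) {F F' : Subgroup (Equiv.Perm Ω)} (h : F ≤ F') :
    U c F ≤ G c F F' := by
  intro g hg
  refine ⟨?_, fun v => h (hg v)⟩
  have : {v | localPerm c g v ∉ F} = ∅ := Set.eq_empty_of_forall_notMem fun v hv => hv (hg v)
  change {v | localPerm c g v ∉ F}.Finite
  rw [this]
  exact Set.finite_empty

theorem aut_ext {g h : T ≃g T} (H : ∀ v, g v = h v) : g = h := RelIso.ext H

theorem inv_apply_eq_iff (g : T ≃g T) {v w : V} : g⁻¹ v = w ↔ v = g w := by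
  constructor
  · rintro rfl
    simp
  · rintro rfl
    simp

/-! ### Automorphisms supported in half-trees -/

/-- The automorphism `g` fixes every vertex outside `X`. -/
def FixesOff (g : T ≃g T) (X : Set V) : Prop := ∀ w ∉ X, g w = w

theorem FixesOff.mono {g : T ≃g T} {X Y : Set V} (h : FixesOff g X) (hXY : X ⊆ Y) :
    FixesOff g Y := fun w hw => h w fun hX => hw (hXY hX)

theorem FixesOff.inv {g : T ≃g T} {X : Set V} (h : FixesOff g X) : FixesOff g⁻¹ X := by
  intro w hw
  rw [inv_apply_eq_iff, h w hw]

theorem FixesOff.mem {g : T ≃g T} {X : Set V} (h : FixesOff g X) {w : V} (hw : w ∈ X) :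
    g w ∈ X := by
  by_contra hcon
  have := h _ hcon
  rw [g.injective this] at hcon
  exact hcon hw

theorem FixesOff.conj {g h : T ≃g T} {X Y : Set V} (hg : FixesOff g X)
    (hXY : ∀ w ∈ X, h w ∈ Y) : FixesOff (h * g * h⁻¹) Y := by
  intro w hw
  rw [RelIso.mul_apply, RelIso.mul_apply, hg, RelIso.apply_inv_self]
  intro hcon
  apply hw
  simpa using hXY _ hcon

theorem FixesOff.commute {g h : T ≃g T} {X Y : Set V} (hg : FixesOff g X) (hh : FixesOff h Y)
    (hXY : Disjoint X Y) : g * h = h * g := by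
  refine aut_ext fun w => ?_
  rw [RelIso.mul_apply, RelIso.mul_apply]
  by_cases hX : w ∈ X
  · rw [hh w (Set.disjoint_left.1 hXY hX), hh _ (Set.disjoint_left.1 hXY (hg.mem hX))]
  · rw [hg w hX]
    by_cases hY : w ∈ Y
    · exact hg _ (Set.disjoint_right.1 hXY (hh.mem hY))
    · rw [hh w hY, hg w hX]

/-- `g` fixes `v` and all its neighbours but one, hence also the last. -/
theorem FixesOff.map_root (c : LegalColoring T Ω) {g : T ≃g T}
    {v : V} {a : Ω} (hT : T.IsTree) (h : FixesOff g (halfTree c v a)) :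
    g (nb c v a) = nb c v a := by
  have hv := h v (self_notMem_halfTree c v a)
  have h1 := map_nb c g v a
  rw [hv] at h1
  rw [h1]
  by_contra hne
  have h2 : localPerm c g v a ≠ a := fun h => hne (by rw [h])
  have h3 : nb c v (localPerm c g v a) ∉ halfTree c v a := fun hcon =>
    h2 (halfTree_unique hT c (nb_mem_halfTree c _ _) hcon)
  have h4 := h _ h3
  rw [← h1] at h4
  exact hne (h1.symm.trans (g.injective h4))

theorem FixesOff.mem_typePreserving (hT : T.IsTree) (c : LegalColoring T Ω) {g : T ≃g T}
    {v : V} {a : Ω} (h : FixesOff g (halfTree c v a)) : g ∈ typePreserving T := by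
  rw [mem_typePreserving_iff hT c g v, h v (self_notMem_halfTree c v a)]
  simp

theorem FixesOff.localPerm_eq_one (hT : T.IsTree) (c : LegalColoring T Ω) {g : T ≃g T} {v w : V}
    {a : Ω} (h : FixesOff g (halfTree c v a)) (hw : w ∉ halfTree c v a) : localPerm c g w = 1 := by
  refine localPerm_eq_of_map_nb c g w 1 fun b => ?_
  rw [h w hw, Equiv.Perm.one_apply]
  by_cases hb : nb c w b ∈ halfTree c v a
  · rw [notMem_halfTree hT] at hw
    have h2 : nb c w b ∉ halfTree c (nb c v a) a := by
      rw [notMem_halfTree hT, nb_nb]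
      exact hb
    obtain ⟨h3, rfl⟩ := nb_mem_halfTree_of_mem hT c hw h2
    rw [nb_nb] at h3
    rw [h3]
    exact h.map_root c hT
  · exact h _ hb

/-- An automorphism that fixes an edge can be restricted to a half-tree bounded by this edge. -/
theorem exists_restrict (hT : T.IsTree) (c : LegalColoring T Ω) (g : T ≃g T) {v : V} {a : Ω}
    (hv : g v = v) (ha : g (nb c v a) = nb c v a) :
    ∃ h : T ≃g T, FixesOff h (halfTree c v a) ∧ (∀ w ∈ halfTree c v a, h w = g w) ∧
      (∀ w ∈ halfTree c v a, localPerm c h w = localPerm c g w) := by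
  classical
  have hside : ∀ {w b}, w ∈ halfTree c v a → nb c w b ∉ halfTree c v a →
      g w = w ∧ g (nb c w b) = nb c w b := by
    intro w b hw hb
    obtain ⟨rfl, rfl⟩ := nb_mem_halfTree_of_mem hT c hw hb
    rw [nb_nb]
    exact ⟨ha, hv⟩
  obtain ⟨h, hk, hs⟩ := exists_aut_of_map hT c
    (fun w => if w ∈ halfTree c v a then g w else w)
    (fun w => if w ∈ halfTree c v a then localPerm c g w else 1) (by
      intro w b
      by_cases hw : w ∈ halfTree c v a <;> by_cases hb : nb c w b ∈ halfTree c v a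
      · simp only [hw, hb, if_true]
        exact map_nb c g w b
      · simp only [hw, hb, if_true, if_false]
        rw [← map_nb, (hside hw hb).2]
      · simp only [hw, hb, if_true, if_false]
        have := (hside (b := b) hb (by rwa [nb_nb])).1
        simpa using this
      · simp [hw, hb])
  refine ⟨h, fun w hw => ?_, fun w hw => ?_, fun w hw => ?_⟩
  · simp [hk, hw]
  · simp [hk, hw]
  · simp [hs, hw]

/-- Automorphisms supported in pairwise disjoint half-trees can be multiplied. -/
theorem exists_disjoint_product (hT : T.IsTree) (c : LegalColoring T Ω) {ι : Type*}
    (h : ι → (T ≃g T)) (v : ι → V) (a : ι → Ω)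
    (hfix : ∀ i, FixesOff (h i) (halfTree c (v i) (a i)))
    (hdisj : ∀ i j w, w ∈ halfTree c (v i) (a i) → w ∈ halfTree c (v j) (a j) → i = j) :
    ∃ k : T ≃g T, (∀ i, ∀ w ∈ halfTree c (v i) (a i), k w = h i w) ∧
      (∀ w, (∀ i, w ∉ halfTree c (v i) (a i)) → k w = w) ∧
      ∀ w, localPerm c k w = 1 ∨ ∃ i, localPerm c k w = localPerm c (h i) w := by
  classical
  have hroot : ∀ i w b, w ∉ halfTree c (v i) (a i) → nb c w b ∈ halfTree c (v i) (a i) →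
      h i (nb c w b) = nb c w b := by
    intro i w b hw hb
    obtain ⟨h1, -⟩ := nb_mem_halfTree_of_mem hT c hb (b := b) (by rwa [nb_nb])
    rw [h1]
    exact (hfix i).map_root c hT
  let k : V → V := fun w => if hw : ∃ i, w ∈ halfTree c (v i) (a i) then h hw.choose w else w
  let s : V → Equiv.Perm Ω := fun w =>
    if hw : ∃ i, w ∈ halfTree c (v i) (a i) then localPerm c (h hw.choose) w else 1
  have hk1 : ∀ i, ∀ w ∈ halfTree c (v i) (a i), k w = h i w := by
    intro i w hw
    have hex : ∃ i, w ∈ halfTree c (v i) (a i) := ⟨i, hw⟩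
    have : hex.choose = i := hdisj _ _ w hex.choose_spec hw
    simp only [k]
    rw [dif_pos hex, this]
  have hs1 : ∀ i, ∀ w ∈ halfTree c (v i) (a i), s w = localPerm c (h i) w := by
    intro i w hw
    have hex : ∃ i, w ∈ halfTree c (v i) (a i) := ⟨i, hw⟩
    have : hex.choose = i := hdisj _ _ w hex.choose_spec hw
    simp only [s]
    rw [dif_pos hex, this]
  have hk2 : ∀ w, (∀ i, w ∉ halfTree c (v i) (a i)) → k w = w := fun w hw =>
    dif_neg fun ⟨i, hi⟩ => hw i hi
  have hs2 : ∀ w, (∀ i, w ∉ halfTree c (v i) (a i)) → s w = 1 := fun w hw =>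
    dif_neg fun ⟨i, hi⟩ => hw i hi
  have hkout : ∀ i w b, w ∉ halfTree c (v i) (a i) → nb c w b ∈ halfTree c (v i) (a i) →
      k (nb c w b) = nb c w b := fun i w b hw hb => by rw [hk1 i _ hb, hroot i w b hw hb]
  -- Only edges crossing the boundary of a support need care. Outer ends are fixed by the factor
  -- supported there, and an end lying in another support is the root of that support, which is
  -- fixed too.
  obtain ⟨g, hg, hgs⟩ := exists_aut_of_map hT c k s (by
    intro w b
    by_cases hw : ∃ i, w ∈ halfTree c (v i) (a i)
    · obtain ⟨i, hi⟩ := hw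
      rw [hk1 i w hi, hs1 i w hi, ← map_nb]
      by_cases hb : nb c w b ∈ halfTree c (v i) (a i)
      · exact hk1 i _ hb
      · rw [hfix i _ hb]
        by_cases hb' : ∃ j, nb c w b ∈ halfTree c (v j) (a j)
        · obtain ⟨j, hj⟩ := hb'
          refine hkout j w b (fun hcon => ?_) hj
          have := hdisj _ _ _ hi hcon
          subst this
          exact hb hj
        · exact hk2 _ (not_exists.1 hb')
    · rw [hk2 w (not_exists.1 hw), hs2 w (not_exists.1 hw), Equiv.Perm.one_apply]
      by_cases hb' : ∃ j, nb c w b ∈ halfTree c (v j) (a j)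
      · obtain ⟨j, hj⟩ := hb'
        exact hkout j w b (not_exists.1 hw j) hj
      · exact hk2 _ (not_exists.1 hb'))
  refine ⟨g, fun i w hw => by rw [hg, hk1 i w hw], fun w hw => by rw [hg, hk2 w hw], fun w => ?_⟩
  rw [hgs]
  by_cases hw : ∃ i, w ∈ halfTree c (v i) (a i)
  · exact Or.inr ⟨_, dif_pos hw⟩
  · exact Or.inl (dif_neg hw)

/-- An automorphism fixing `v` with local permutation `p` at `v` and constant local permutations on
each of the half-trees at `v`. -/
theorem exists_aut_of_star (hT : T.IsTree) (c : LegalColoring T Ω) (v : V) (p : Equiv.Perm Ω)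
    (f : Ω → Equiv.Perm Ω) (hf : ∀ b, f b b = p b) :
    ∃ g : T ≃g T, g v = v ∧ localPerm c g v = p ∧
      ∀ b, ∀ w ∈ halfTree c v b, localPerm c g w = f b := by
  classical
  let s : V → Equiv.Perm Ω := fun w =>
    if hw : w ≠ v then f (exists_mem_halfTree hT c hw).choose else p
  have hsv : s v = p := dif_neg (by simp)
  have hs : ∀ b, ∀ w ∈ halfTree c v b, s w = f b := by
    intro b w hw
    have hne : w ≠ v := by
      rintro rfl
      exact self_notMem_halfTree c _ _ hw
    simp only [s]
    rw [dif_pos hne,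
      halfTree_unique hT c (exists_mem_halfTree hT c hne).choose_spec hw]
  obtain ⟨g, hgv, hg⟩ := exists_aut hT c s (by
    intro w e
    by_cases hw : w = v
    · subst hw
      rw [hsv, hs e _ (nb_mem_halfTree c _ _), hf]
    · obtain ⟨b, hb⟩ := exists_mem_halfTree hT c hw
      by_cases he : nb c w e ∈ halfTree c v b
      · rw [hs b _ hb, hs b _ he]
      · obtain ⟨rfl, rfl⟩ := nb_mem_halfTree_of_mem hT c hb he
        rw [nb_nb, hsv, hs e _ hb, hf]) v v
  exact ⟨g, hgv, by rw [hg, hsv], fun b w hw => by rw [hg, hs b w hw]⟩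

theorem eq_of_localPerm_eq_one (hT : T.IsTree) (c : LegalColoring T Ω) {g : T ≃g T} {v : V}
    {a : Ω} (hv : g (nb c v a) = nb c v a)
    (h : ∀ w ∈ halfTree c v a, localPerm c g w = 1) : ∀ w ∈ halfTree c v a, g w = w := by
  refine halfTree_induction hT c hv fun w b hw _ ih => ?_
  rw [map_nb, ih, h w hw, Equiv.Perm.one_apply]

/-! ### Normal subgroups of the type-preserving group -/

/-- The automorphism `g` moves the set `X` off itself. -/
def Displaces (g : T ≃g T) (X : Set V) : Prop := ∀ w ∈ X, g w ∉ X

theorem Displaces.mono {g : T ≃g T} {X Y : Set V} (h : Displaces g X) (hYX : Y ⊆ X) :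
    Displaces g Y := fun w hw hgw => h w (hYX hw) (hYX hgw)

theorem exists_ne_ne [Finite Ω] (hΩ : 3 ≤ Nat.card Ω) (a b : Ω) : ∃ d, d ≠ a ∧ d ≠ b := by
  classical
  by_contra! hcon
  have h : Set.univ ⊆ ({a, b} : Set Ω) := fun d _ => by
    by_cases hd : d = a
    · exact Or.inl hd
    · exact Or.inr (hcon d hd)
  have h1 := Set.ncard_le_ncard h (Set.toFinite _)
  have h2 := Set.ncard_insert_le a ({b} : Set Ω)
  rw [Set.ncard_univ] at h1
  rw [Set.ncard_singleton] at h2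
  omega

/-- A nontrivial automorphism moves some half-tree off itself, and the parity of the base vertex of
this half-tree can be prescribed. -/
theorem exists_displaces [Finite Ω] (hΩ : 3 ≤ Nat.card Ω) (hT : T.IsTree) (c : LegalColoring T Ω)
    {g : T ≃g T} (hg : g ≠ 1) (v : V) :
    ∃ y a, Even (T.dist y v) ∧ Displaces g (halfTree c y a) := by
  obtain ⟨y, hy⟩ : ∃ y, g y ≠ y := by
    by_contra! hcon
    exact hg (aut_ext hcon)
  obtain ⟨b₀, hb₀⟩ := exists_mem_halfTree hT c hy
  obtain ⟨b₁, hb₁⟩ := exists_mem_halfTree hT c (Ne.symm hy)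
  -- The half-tree at `y` must point neither towards `g y` nor in the direction that `g` carries to
  -- the one from `g y` back to `y`. Its image then lies in direction `b₀` from `y`, disjoint from
  -- it.
  obtain ⟨a, ha₀, ha₁⟩ := exists_ne_ne hΩ b₀ ((localPerm c g y).symm b₁)
  have hdis : Displaces g (halfTree c y a) := by
    intro w hw hgw
    have h1 := (map_mem_halfTree hT c g).2 hw
    have h2 : y ∉ halfTree c (g y) (localPerm c g y a) := by
      intro h
      have := halfTree_unique hT c h hb₁
      apply ha₁
      rw [← this, Equiv.symm_apply_apply]
    have h3 := halfTree_subset hT c hb₀ h2 h1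
    exact ha₀ (halfTree_unique hT c hgw h3)
  by_cases heven : Even (T.dist y v)
  · exact ⟨y, a, heven, hdis⟩
  -- A half-tree one step further inside has a base of the other parity.
  · obtain ⟨b, hb, -⟩ := exists_ne_ne hΩ a a
    refine ⟨nb c y a, b, ?_, hdis.mono (nb_halfTree_subset hT c hb)⟩
    rcases dist_nb hT c y v a with h | h
    · rwa [h, Nat.even_add_one]
    · rwa [h, Nat.even_add_one, not_not] at heven

/-- `F`-constant automorphisms identify half-trees whose base vertices are at even distance. -/
theorem exists_map_halfTree (hT : T.IsTree) (c : LegalColoring T Ω) {F : Subgroup (Equiv.Perm Ω)}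
    (htrans : MulAction.IsPretransitive F Ω) {y v : V} (h : Even (T.dist y v)) (a b : Ω) :
    ∃ g ∈ U c F ⊓ typePreserving T, ∀ w, g w ∈ halfTree c v b ↔ w ∈ halfTree c y a := by
  obtain ⟨f, hf⟩ := htrans.exists_smul_eq a b
  obtain ⟨g, hgy, hg⟩ := exists_const_aut hT c (f : Equiv.Perm Ω) y v
  refine ⟨g, ⟨fun u => by rw [hg]; exact f.2, ?_⟩, fun w => ?_⟩
  · exact (mem_typePreserving_iff hT c g y).2 (by rwa [hgy])
  · have h1 : (f : Equiv.Perm Ω) a = b := hf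
    rw [← map_mem_halfTree hT c g (v := y), hgy, hg, h1]

/-- Some half-tree is displaced, and conjugation carries it to the required one. Normalization is
asked only for the type-preserving part of `U c F`, so that this also applies to `N ⊓ U c F`. -/
theorem exists_displaces_of_normalized [Finite Ω] (hΩ : 3 ≤ Nat.card Ω) (hT : T.IsTree)
    (c : LegalColoring T Ω) {F : Subgroup (Equiv.Perm Ω)} (htrans : MulAction.IsPretransitive F Ω)
    {M : Subgroup (T ≃g T)} (hM : M ≠ ⊥)
    (hnorm : ∀ h ∈ U c F ⊓ typePreserving T, ∀ m ∈ M, h * m * h⁻¹ ∈ M) (v : V) (a : Ω) :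
    ∃ m ∈ M, Displaces m (halfTree c v a) := by
  obtain ⟨⟨m, hm⟩, hne⟩ := Subgroup.ne_bot_iff_exists_ne_one.1 hM
  have hm1 : m ≠ 1 := fun h => hne (Subtype.ext h)
  obtain ⟨y, b, hy, hdis⟩ := exists_displaces hΩ hT c hm1 v
  obtain ⟨g, hg, hgX⟩ := exists_map_halfTree hT c htrans hy b a
  refine ⟨_, hnorm g hg _ hm, fun w hw hw' => ?_⟩
  rw [RelIso.mul_apply, RelIso.mul_apply, hgX] at hw'
  refine hdis _ ?_ hw'
  rw [← hgX]
  simpa using hw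

/-! ### Commutators and Tits' argument -/

/-- In [a,n] = a · (n a⁻¹ n⁻¹) the second factor is supported in nX, disjoint from X, so it commutes
with `b`. Hence [[a,n],b] = [a,b], and the left side is in `N`. -/
theorem commutator_mem_of_displaces {N : Subgroup (T ≃g T)} {X : Set V} {n a b : T ≃g T}
    (hn : n ∈ N) (hdis : Displaces n X) (ha : FixesOff a X) (hb : FixesOff b X)
    (hNa : ∀ m ∈ N, a * m * a⁻¹ ∈ N) (hNb : ∀ m ∈ N, b * m * b⁻¹ ∈ N) :
    a * b * a⁻¹ * b⁻¹ ∈ N := by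
  have hc : FixesOff (n * a⁻¹ * n⁻¹) (n '' X) := ha.inv.conj fun w hw => ⟨w, hw, rfl⟩
  have hdisj : Disjoint (n '' X) X := by
    rw [Set.disjoint_left]
    rintro _ ⟨w, hw, rfl⟩
    exact hdis w hw
  have hcomm := hc.commute hb hdisj
  have h1 : a * (n * a⁻¹ * n⁻¹) ∈ N := by
    have := N.mul_mem (hNa n hn) (N.inv_mem hn)
    simpa [mul_assoc] using this
  have h2 := N.mul_mem h1 (hNb _ (N.inv_mem h1))
  have h3 : a * (n * a⁻¹ * n⁻¹) * (b * (a * (n * a⁻¹ * n⁻¹))⁻¹ * b⁻¹) =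
      a * b * a⁻¹ * b⁻¹ := by
    generalize n * a⁻¹ * n⁻¹ = d at hcomm
    calc a * d * (b * (a * d)⁻¹ * b⁻¹) = a * (d * b) * d⁻¹ * a⁻¹ * b⁻¹ := by group
      _ = a * b * a⁻¹ * b⁻¹ := by rw [hcomm]; group
  rwa [h3] at h2

/-- If they commuted, `h₂` would act on Y as it does on hY, where it is trivial. -/
theorem commutator_ne_one {h h₂ : T ≃g T} {Y : Set V} (hdis : Displaces h Y)
    (hfix : FixesOff h₂ Y) (hne : h₂ ≠ 1) : h * h₂ * h⁻¹ * h₂⁻¹ ≠ 1 := by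
  intro hcon
  have hcomm : h * h₂ = h₂ * h := by
    rw [mul_inv_eq_one, mul_inv_eq_iff_eq_mul] at hcon
    exact hcon
  apply hne
  refine aut_ext fun w => ?_
  by_cases hw : w ∈ Y
  · have h1 : h (h₂ w) = h₂ (h w) := by rw [← RelIso.mul_apply, hcomm, RelIso.mul_apply]
    rw [hfix _ (hdis w hw)] at h1
    exact h.injective h1
  · exact hfix w hw

/-- `h` displaces some half-tree Y. A conjugate `h₂` of `h` in `U c F` supported in Y gives a
nontrivial [h,h₂], which lies in `N` because both are supported in one displaced half-tree. -/
theorem inf_U_ne_bot [Finite Ω] (hΩ : 3 ≤ Nat.card Ω) (hT : T.IsTree) (c : LegalColoring T Ω)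
    {F F' : Subgroup (Equiv.Perm Ω)} (hFF' : F ≤ F') (htrans : MulAction.IsPretransitive F Ω)
    {N : Subgroup (T ≃g T)} (hN : N ≠ ⊥)
    (hnorm : ∀ h ∈ G c F F' ⊓ typePreserving T, ∀ n ∈ N, h * n * h⁻¹ ∈ N)
    {h : T ≃g T} (hU : h ∈ U c F) (hne : h ≠ 1) {v : V} {a : Ω}
    (hfix : FixesOff h (halfTree c v a)) : N ⊓ U c F ≠ ⊥ := by
  have hUG := inf_le_inf_right (typePreserving T) (U_le_G c hFF')
  obtain ⟨y, b, hy, hdis⟩ := exists_displaces hΩ hT c hne v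
  obtain ⟨g, hg, hgX⟩ := exists_map_halfTree hT c htrans (T.dist_comm ▸ hy) a b
  have hfix₂ : FixesOff (g * h * g⁻¹) (halfTree c y b) := hfix.conj fun w hw => (hgX w).2 hw
  have hsub : halfTree c y b ⊆ halfTree c v a := by
    intro w hw
    by_contra hcon
    exact hdis w hw (by rwa [hfix w hcon])
  have hU₂ : g * h * g⁻¹ ∈ U c F := mul_mem (mul_mem hg.1 hU) (inv_mem hg.1)
  have hne₂ : g * h * g⁻¹ ≠ 1 := by
    intro hcon
    apply hne
    rw [mul_inv_eq_one] at hcon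
    exact mul_eq_left.1 hcon
  obtain ⟨n, hn, hndis⟩ := exists_displaces_of_normalized hΩ hT c htrans hN
    (fun h hh => hnorm h (hUG hh)) v a
  have hmem := commutator_mem_of_displaces hn hndis hfix (hfix₂.mono hsub)
    (hnorm h (hUG ⟨hU, hfix.mem_typePreserving hT c⟩))
    (hnorm _ (hUG ⟨hU₂, hfix₂.mem_typePreserving hT c⟩))
  have hmem' : h * (g * h * g⁻¹) * h⁻¹ * (g * h * g⁻¹)⁻¹ ∈ U c F :=
    mul_mem (mul_mem (mul_mem hU hU₂) (inv_mem hU)) (inv_mem hU₂)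
  intro hbot
  have : h * (g * h * g⁻¹) * h⁻¹ * (g * h * g⁻¹)⁻¹ ∈ N ⊓ U c F := ⟨hmem, hmem'⟩
  rw [hbot, Subgroup.mem_bot] at this
  exact commutator_ne_one hdis hfix₂ hne₂ this

/-- If the translates of a half-tree under the powers of `t` are pairwise disjoint, then an
automorphism `h` supported in this half-tree is a commutator `[k, t]`. -/
theorem exists_commutator_eq (hT : T.IsTree) (c : LegalColoring T Ω)
    {F : Subgroup (Equiv.Perm Ω)} {h t : T ≃g T} (hh : h ∈ U c F) (ht : t ∈ U c F) {v : V} {a : Ω}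
    (hfix : FixesOff h (halfTree c v a)) {Z : Set V} (htX : ∀ w ∈ halfTree c v a, t w ∈ Z)
    (htZ : ∀ w ∈ Z, t w ∈ Z) (hXZ : Disjoint (halfTree c v a) Z) (hvZ : v ∉ Z) :
    ∃ k ∈ U c F ⊓ typePreserving T, k * t * k⁻¹ * t⁻¹ = h := by
  have hpow : ∀ n, ∀ w ∈ halfTree c v a, (t ^ (n + 1)) w ∈ Z := by
    intro n
    induction n with
    | zero => simpa using htX
    | succ n ih =>
      intro w hw
      rw [pow_succ', RelIso.mul_apply]
      exact htZ _ (ih w hw)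
  have hmem : ∀ (n : ℕ) w, w ∈ halfTree c ((t ^ n) v) (localPerm c (t ^ n) v a) ↔
      (t ^ n)⁻¹ w ∈ halfTree c v a := by
    intro n w
    rw [← map_mem_halfTree hT c (t ^ n) (w := (t ^ n)⁻¹ w), RelIso.apply_inv_self]
  have hZ : ∀ (n : ℕ) w, (t ^ (n + 1))⁻¹ w ∈ halfTree c v a → w ∈ Z := by
    intro n w hw
    simpa using hpow n _ hw
  have hlt : ∀ i j w, i < j → (t ^ i)⁻¹ w ∈ halfTree c v a → (t ^ j)⁻¹ w ∉ halfTree c v a := by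
    intro i j w hij hi hj
    obtain ⟨d, rfl⟩ := Nat.exists_eq_add_of_lt hij
    refine Set.disjoint_left.1 hXZ hi (hZ d _ ?_)
    rwa [← RelIso.mul_apply, ← mul_inv_rev, ← pow_add, ← add_assoc]
  -- `k` is the product of the t^n h t^(-n) over n ≥ 0. Conjugation by `t` shifts the factors and
  -- drops the one with n = 0, so k (t k t⁻¹)⁻¹ = h.
  obtain ⟨k, hk1, hk2, hks⟩ := exists_disjoint_product hT c (fun n : ℕ => t ^ n * h * (t ^ n)⁻¹)
    (fun n => (t ^ n) v) (fun n => localPerm c (t ^ n) v a)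
    (fun n => hfix.conj fun w hw => (map_mem_halfTree hT c _).2 hw) (by
      intro i j w hi hj
      rw [hmem] at hi hj
      rcases lt_trichotomy i j with hij | hij | hij
      · exact absurd hj (hlt i j w hij hi)
      · exact hij
      · exact absurd hi (hlt j i w hij hj))
  simp only [hmem] at hk1 hk2
  have hkU : k ∈ U c F := by
    intro w
    rcases hks w with h1 | ⟨i, h1⟩
    · rw [h1]
      exact one_mem F
    · rw [h1]
      exact mul_mem (mul_mem (pow_mem ht i) hh) (inv_mem (pow_mem ht i)) w
  have hkv : k v = v := by
    refine hk2 v fun i hi => ?_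
    cases i with
    | zero => exact self_notMem_halfTree c v a (by simpa using hi)
    | succ n => exact hvZ (hZ n v hi)
  refine ⟨k, ⟨hkU, (mem_typePreserving_iff hT c k v).2 (by simp [hkv])⟩, ?_⟩
  rw [mul_inv_eq_iff_eq_mul, mul_inv_eq_iff_eq_mul]
  refine aut_ext fun w => ?_
  simp only [RelIso.mul_apply]
  have hsucc : ∀ i w, (t ^ (i + 1))⁻¹ (t w) = (t ^ i)⁻¹ w := by
    intro i w
    rw [← RelIso.mul_apply, pow_succ', mul_inv_rev, mul_assoc, inv_mul_cancel, mul_one]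
  by_cases hw : ∃ i, (t ^ i)⁻¹ w ∈ halfTree c v a
  · obtain ⟨i, hi⟩ := hw
    rw [hk1 i w hi, hk1 (i + 1) (t w) (by rwa [hsucc])]
    simp only [RelIso.mul_apply, hsucc]
    have h1 : t ((t ^ i) (h ((t ^ i)⁻¹ w))) = (t ^ (i + 1)) (h ((t ^ i)⁻¹ w)) := by
      rw [pow_succ', RelIso.mul_apply]
    rw [h1]
    exact (hfix _ (Set.disjoint_right.1 hXZ (hpow i _ (hfix.mem hi)))).symm
  · push Not at hw
    rw [hk2 w hw]
    by_cases h0 : t w ∈ halfTree c v a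
    · simpa using hk1 0 (t w) (by simpa using h0)
    · rw [hfix _ h0]
      refine hk2 _ fun i => ?_
      cases i with
      | zero => simpa using h0
      | succ n =>
        rw [hsucc]
        exact hw n

theorem mem_of_fixesOff [Finite Ω] (hΩ : 3 ≤ Nat.card Ω) (hT : T.IsTree) (c : LegalColoring T Ω)
    {F F' : Subgroup (Equiv.Perm Ω)} (hFF' : F ≤ F') (htrans : MulAction.IsPretransitive F Ω)
    {N : Subgroup (T ≃g T)} (hN : N ≠ ⊥)
    (hnorm : ∀ h ∈ G c F F' ⊓ typePreserving T, ∀ n ∈ N, h * n * h⁻¹ ∈ N)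
    {h : T ≃g T} (hU : h ∈ U c F) {v : V} {a : Ω}
    (hfix : FixesOff h (halfTree c v a)) : h ∈ N := by
  by_cases hne : h = 1
  · rw [hne]
    exact one_mem N
  have hUG := inf_le_inf_right (typePreserving T) (U_le_G c hFF')
  have hdisp := exists_displaces_of_normalized hΩ hT c htrans
    (inf_U_ne_bot hΩ hT c hFF' htrans hN hnorm hU hne hfix) (fun h hh m hm =>
      ⟨hnorm h (hUG hh) m hm.1, (U c F).mul_mem ((U c F).mul_mem hh.1 hm.2) ((U c F).inv_mem hh.1)⟩)
  obtain ⟨b, hba, -⟩ := exists_ne_ne hΩ a a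
  obtain ⟨d, hda, hdb⟩ := exists_ne_ne hΩ a b
  -- Ping-pong with three colours: the complement of direction `d` contains directions `a` and `b`.
  -- `s` maps it into direction `d`, hence off direction `b`, and `u` then maps it into direction
  -- `b`. So `t = u * s` sends directions `a` and `b` into `b`.
  obtain ⟨s, hs, hsW⟩ := hdisp (nb c v d) d
  obtain ⟨u, hu, huZ⟩ := hdisp (nb c v b) b
  have hstep : ∀ w ∈ halfTree c (nb c v d) d, (u * s) w ∈ halfTree c v b := by
    intro w hw
    by_contra hcon
    rw [notMem_halfTree hT] at hcon
    refine huZ (s w) ?_ hcon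
    rw [← notMem_halfTree hT]
    exact fun h1 => hsW w hw (halfTree_subset_nb hT c hdb.symm h1)
  obtain ⟨k, hk, hkt⟩ := exists_commutator_eq hT c hU (mul_mem hu.2 hs.2) hfix
    (Z := halfTree c v b)
    (fun w hw => hstep w (halfTree_subset_nb hT c hda.symm hw))
    (fun w hw => hstep w (halfTree_subset_nb hT c hdb.symm hw))
    (Set.disjoint_left.2 fun w h1 h2 => hba (halfTree_unique hT c h2 h1))
    (self_notMem_halfTree c v b)
  rw [← hkt]
  have ht : u * s ∈ N := mul_mem hu.1 hs.1
  exact mul_mem (hnorm k (hUG hk) _ ht) (inv_mem ht)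

/-- Such an element is the product of its restrictions to the two sides of the edge, and both
restrictions stay in `U c F`. -/
theorem mem_of_fixes_edge [Finite Ω] (hΩ : 3 ≤ Nat.card Ω) (hT : T.IsTree)
    (c : LegalColoring T Ω)
    {F F' : Subgroup (Equiv.Perm Ω)} (hFF' : F ≤ F') (htrans : MulAction.IsPretransitive F Ω)
    {N : Subgroup (T ≃g T)} (hN : N ≠ ⊥)
    (hnorm : ∀ h ∈ G c F F' ⊓ typePreserving T, ∀ n ∈ N, h * n * h⁻¹ ∈ N)
    {h : T ≃g T} (hU : h ∈ U c F) {v : V} {a : Ω} (hv : h v = v)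
    (ha : h (nb c v a) = nb c v a) : h ∈ N := by
  obtain ⟨r, hr, hrX, hrs⟩ := exists_restrict hT c h hv ha
  have hrU : r ∈ U c F := by
    intro w
    by_cases hw : w ∈ halfTree c v a
    · rw [hrs w hw]
      exact hU w
    · rw [hr.localPerm_eq_one hT c hw]
      exact one_mem F
  have h1 := mem_of_fixesOff hΩ hT c hFF' htrans hN hnorm hrU hr
  have h2 : r⁻¹ * h ∈ N := by
    refine mem_of_fixesOff hΩ hT c hFF' htrans hN hnorm (mul_mem (inv_mem hrU) hU)
      (v := nb c v a) (a := a) fun w hw => ?_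
    rw [← notMem_halfTree hT, not_not] at hw
    rw [RelIso.mul_apply, inv_apply_eq_iff, hrX w hw]
  simpa using mul_mem h1 h2

/-! ### Local actions of a normal subgroup and removal of singularities -/

/-- Local permutations fixing the colour `a` are realised by automorphisms with a single
singularity that fix one side of the edge of colour `a`. -/
theorem exists_fixesOff_localPerm (hT : T.IsTree) (c : LegalColoring T Ω)
    {F : Subgroup (Equiv.Perm Ω)} (htrans : MulAction.IsPretransitive F Ω) (v : V) {a : Ω}
    {p : Equiv.Perm Ω} (hp : p a = a) :
    ∃ g : T ≃g T, g v = v ∧ FixesOff g (halfTree c (nb c v a) a) ∧ localPerm c g v = p ∧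
      ∀ w, w ≠ v → localPerm c g w ∈ F := by
  -- Transitivity of `F` extends `p` constantly along each direction; along `a` the identity is
  -- possible because `p` fixes `a`.
  have hex : ∀ b, ∃ f ∈ F, f b = p b ∧ (b = a → f = 1) := by
    intro b
    by_cases hb : b = a
    · subst hb
      exact ⟨1, one_mem F, hp.symm, fun _ => rfl⟩
    · obtain ⟨f, hf⟩ := htrans.exists_smul_eq b (p b)
      exact ⟨f, f.2, hf, fun h => absurd h hb⟩
  choose f hfF hf hfa using hex
  obtain ⟨g, hgv, hgp, hg⟩ := exists_aut_of_star hT c v p f hf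
  refine ⟨g, hgv, fun w hw => ?_, hgp, fun w hw => ?_⟩
  · rw [← notMem_halfTree hT, not_not] at hw
    refine eq_of_localPerm_eq_one hT c ?_ (fun w hw => ?_) w hw
    · rw [map_nb, hgv, hgp, hp]
    · rw [hg a w hw, hfa a rfl]
  · obtain ⟨b, hb⟩ := exists_mem_halfTree hT c hw
    rw [hg b w hb]
    exact hfF b

theorem mem_G_of_single (c : LegalColoring T Ω) {F F' : Subgroup (Equiv.Perm Ω)} (hFF' : F ≤ F')
    {g : T ≃g T} {v : V} (hv : localPerm c g v ∈ F') (h : ∀ w, w ≠ v → localPerm c g w ∈ F) :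
    g ∈ G c F F' := by
  refine ⟨(Set.finite_singleton v).subset fun w hw => ?_, fun w => ?_⟩
  · by_contra hne
    exact hw (h w hne)
  · by_cases hw : w = v
    · rwa [hw]
    · exact hFF' (h w hw)

/-- The local permutations at `v` of the elements of `N` that fix `v` and have no other
singularity. -/
def starAction (c : LegalColoring T Ω) (F : Subgroup (Equiv.Perm Ω)) (N : Subgroup (T ≃g T))
    (v : V) : Subgroup (Equiv.Perm Ω) where
  carrier := {p | ∃ g ∈ N, g v = v ∧ localPerm c g v = p ∧ ∀ w, w ≠ v → localPerm c g w ∈ F}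
  mul_mem' := by
    rintro _ _ ⟨g, hg, hgv, rfl, hgF⟩ ⟨h, hh, hhv, rfl, hhF⟩
    refine ⟨g * h, mul_mem hg hh, by rw [RelIso.mul_apply, hhv, hgv],
      by rw [localPerm_mul, hhv], fun w hw => ?_⟩
    rw [localPerm_mul]
    refine mul_mem (hgF _ fun hcon => hw (h.injective ?_)) (hhF w hw)
    rw [hcon, hhv]
  one_mem' := ⟨1, one_mem N, rfl, localPerm_one c v, fun w _ => by
    rw [localPerm_one]
    exact one_mem F⟩
  inv_mem' := by
    rintro _ ⟨g, hg, hgv, rfl, hgF⟩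
    have hgv' : g⁻¹ v = v := by rw [inv_apply_eq_iff, hgv]
    refine ⟨g⁻¹, inv_mem hg, hgv', by rw [localPerm_inv, hgv'], fun w hw => ?_⟩
    rw [localPerm_inv]
    refine inv_mem (hgF _ fun hcon => hw ?_)
    rw [inv_apply_eq_iff, hgv] at hcon
    exact hcon

/-- It is enough to treat the generators. Lifts of F'_a are supported in a common half-tree, so
their commutators are in `N`; lifts of F_a have no singularity at all, so Tits' argument applies to
them. -/
theorem le_starAction [Finite Ω] (hΩ : 3 ≤ Nat.card Ω) (hT : T.IsTree)
    (c : LegalColoring T Ω)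
    {F F' : Subgroup (Equiv.Perm Ω)} (hFF' : F ≤ F') (htrans : MulAction.IsPretransitive F Ω)
    (hgen : F' ≤ Subgroup.closure (⋃ a : Ω,
      ((⁅pointStabilizer F' a, pointStabilizer F' a⁆ : Subgroup (Equiv.Perm Ω)) :
        Set (Equiv.Perm Ω)) ∪ (pointStabilizer F a : Set (Equiv.Perm Ω))))
    {N : Subgroup (T ≃g T)} (hN : N ≠ ⊥)
    (hnorm : ∀ h ∈ G c F F' ⊓ typePreserving T, ∀ n ∈ N, h * n * h⁻¹ ∈ N) (v : V) :
    F' ≤ starAction c F N v := by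
  have hUG := inf_le_inf_right (typePreserving T) (U_le_G c hFF')
  refine hgen.trans ((Subgroup.closure_le _).2 (Set.iUnion_subset fun a => ?_))
  have hlift : ∀ p ∈ pointStabilizer F' a, ∃ g ∈ G c F F', g v = v ∧
      FixesOff g (halfTree c (nb c v a) a) ∧ localPerm c g v = p ∧
      ∀ w, w ≠ v → localPerm c g w ∈ F := by
    intro p hp
    obtain ⟨g, hgv, hgX, hgp, hgF⟩ := exists_fixesOff_localPerm hT c htrans v (p := p) hp.2
    exact ⟨g, mem_G_of_single c hFF' (by rw [hgp]; exact hp.1) hgF, hgv, hgX, hgp, hgF⟩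
  refine Set.union_subset ?_ ?_
  · refine Subgroup.commutator_le.2 fun p hp q hq => ?_
    obtain ⟨g, hg, hgv, hgX, rfl, hgF⟩ := hlift p hp
    obtain ⟨h, hh, hhv, hhX, rfl, hhF⟩ := hlift q hq
    obtain ⟨n, hn, hndis⟩ := exists_displaces_of_normalized hΩ hT c htrans hN
      (fun h hh => hnorm h (hUG hh)) (nb c v a) a
    have hmem := commutator_mem_of_displaces hn hndis hgX hhX
      (hnorm g ⟨hg, hgX.mem_typePreserving hT c⟩) (hnorm h ⟨hh, hhX.mem_typePreserving hT c⟩)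
    have hgv' : g⁻¹ v = v := by rw [inv_apply_eq_iff, hgv]
    have hhv' : h⁻¹ v = v := by rw [inv_apply_eq_iff, hhv]
    have hgF' : ∀ w, w ≠ v → localPerm c g⁻¹ w ∈ F := fun w hw => by
      rw [localPerm_inv]
      refine inv_mem (hgF _ ?_)
      rwa [Ne, inv_apply_eq_iff, hgv]
    have hhF' : ∀ w, w ≠ v → localPerm c h⁻¹ w ∈ F := fun w hw => by
      rw [localPerm_inv]
      refine inv_mem (hhF _ ?_)
      rwa [Ne, inv_apply_eq_iff, hhv]
    refine ⟨_, hmem, ?_, ?_, fun w hw => ?_⟩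
    · simp only [RelIso.mul_apply, hgv, hhv, hgv', hhv']
    · simp only [localPerm_mul, localPerm_inv, hhv, hgv', hhv', commutatorElement_def]
    · have h1 : h⁻¹ w ≠ v := by rwa [Ne, inv_apply_eq_iff, hhv]
      have h2 : g⁻¹ (h⁻¹ w) ≠ v := by rwa [Ne, inv_apply_eq_iff, hgv]
      have h3 : h (g⁻¹ (h⁻¹ w)) ≠ v := fun hcon => h2 (h.injective (by rw [hcon, hhv]))
      simp only [localPerm_mul]
      exact mul_mem (mul_mem (mul_mem (hgF _ h3) (hhF _ h2)) (hgF' _ h1)) (hhF' _ hw)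
  · intro p hp
    obtain ⟨g, hgv, hgX, rfl, hgF⟩ := exists_fixesOff_localPerm hT c htrans v (p := p) hp.2
    refine ⟨g, mem_of_fixesOff hΩ hT c hFF' htrans hN hnorm (fun w => ?_) hgX, hgv, rfl, hgF⟩
    by_cases hw : w = v
    · rw [hw]
      exact hp.1
    · exact hgF w hw

/-- The geodesic from `w` to `v₀` passes through `v`. In the induction `v` advances towards `v₀`. -/
theorem dist_eq_add (hT : T.IsTree) (c : LegalColoring T Ω) {v v₀ w : V} {a : Ω}
    (h₀ : v₀ ∈ halfTree c v a) (hw : w ∉ halfTree c v a) :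
    T.dist w v₀ = T.dist w v + T.dist v v₀ := by
  obtain ⟨n, hn⟩ : ∃ n, T.dist (nb c v a) v₀ = n := ⟨_, rfl⟩
  have hwv : T.dist w (nb c v a) = T.dist w v + 1 := by
    rw [notMem_halfTree hT, mem_halfTree, nb_nb] at hw
    rwa [T.dist_comm (u := w), T.dist_comm (u := w)]
  rw [mem_halfTree] at h₀
  induction n generalizing v a with
  | zero =>
    have := hT.connected.dist_eq_zero_iff.1 hn
    subst this
    rw [hwv, h₀, SimpleGraph.dist_self]
  | succ n ih =>
    have hne : v₀ ≠ nb c v a := by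
      rintro rfl
      simp at hn
    obtain ⟨b, hb⟩ := exists_mem_halfTree hT c hne
    have hb' := hb
    rw [mem_halfTree] at hb'
    have hwb : w ∉ halfTree c (nb c v a) b := by
      intro hcon
      have := halfTree_unique hT c hcon ((notMem_halfTree hT c).1 hw)
      subst this
      exact (notMem_halfTree hT c).2 hb h₀
    have hwv' : T.dist w (nb c (nb c v a) b) = T.dist w (nb c v a) + 1 := by
      rw [notMem_halfTree hT, mem_halfTree, nb_nb] at hwb
      rwa [T.dist_comm (u := w), T.dist_comm (u := w)]
    have := ih (v := nb c v a) (a := b) hb' hwb (by omega) hwv'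
    omega

/-- Dividing by an element of `N` with the same local permutation at `v` leaves an element of `U c
F` that fixes the star of `v`, in particular an edge. -/
theorem mem_of_single [Finite Ω] (hΩ : 3 ≤ Nat.card Ω) (hT : T.IsTree)
    (c : LegalColoring T Ω)
    {F F' : Subgroup (Equiv.Perm Ω)} (hFF' : F ≤ F') (htrans : MulAction.IsPretransitive F Ω)
    {N : Subgroup (T ≃g T)} (hN : N ≠ ⊥)
    (hnorm : ∀ h ∈ G c F F' ⊓ typePreserving T, ∀ n ∈ N, h * n * h⁻¹ ∈ N) {v : V}
    (hstar : F' ≤ starAction c F N v) {g : T ≃g T} (hgv : g v = v) (hg : localPerm c g v ∈ F')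
    (hgF : ∀ w, w ≠ v → localPerm c g w ∈ F) : g ∈ N := by
  obtain ⟨k, hk, hkv, hkp, hkF⟩ := hstar hg
  have hkv' : k⁻¹ v = v := by rw [inv_apply_eq_iff, hkv]
  have hv : localPerm c (k⁻¹ * g) v = 1 := by
    rw [localPerm_mul, hgv, localPerm_inv, hkv', hkp, inv_mul_cancel]
  have hfix : (k⁻¹ * g) v = v := by rw [RelIso.mul_apply, hgv, hkv']
  have hU : k⁻¹ * g ∈ U c F := by
    intro w
    by_cases hw : w = v
    · rw [hw, hv]
      exact one_mem F
    · rw [localPerm_mul, localPerm_inv]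
      refine mul_mem (inv_mem (hkF _ fun hcon => hw ?_)) (hgF w hw)
      rw [inv_apply_eq_iff, hkv] at hcon
      exact g.injective (hcon.trans hgv.symm)
  have : Nonempty Ω := (Nat.card_pos_iff.1 (by omega)).1
  have h1 := mem_of_fixes_edge hΩ hT c hFF' htrans hN hnorm hU (a := Classical.arbitrary Ω) hfix
    (by rw [map_nb, hv, hfix, Equiv.Perm.one_apply])
  simpa using mul_mem hk h1

/-- Two steps at a time: an element of `N` turning about the next vertex on the geodesic carries `v`
to the vertex after it. -/
theorem exists_mem_map_eq (hT : T.IsTree) (c : LegalColoring T Ω)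
    {F F' : Subgroup (Equiv.Perm Ω)} (hFF' : F ≤ F') (htrans : MulAction.IsPretransitive F Ω)
    {N : Subgroup (T ≃g T)} (hstar : ∀ v, F' ≤ starAction c F N v) (v w : V)
    (h : Even (T.dist v w)) : ∃ g ∈ N, g v = w := by
  obtain ⟨n, hn⟩ := h
  induction n generalizing v with
  | zero =>
    have := hT.connected.dist_eq_zero_iff.1 hn
    exact ⟨1, one_mem N, this⟩
  | succ n ih =>
    have hne : w ≠ v := by
      rintro rfl
      simp at hn
    obtain ⟨a, ha⟩ := exists_mem_halfTree hT c hne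
    rw [mem_halfTree] at ha
    have hne' : w ≠ nb c v a := by
      rintro rfl
      rw [SimpleGraph.dist_self] at ha
      omega
    obtain ⟨b, hb⟩ := exists_mem_halfTree hT c hne'
    rw [mem_halfTree] at hb
    obtain ⟨g, hg, hgw⟩ := ih (nb c (nb c v a) b) (by omega)
    obtain ⟨f, hf⟩ := htrans.exists_smul_eq a b
    obtain ⟨k, hk, hkv, hkp, -⟩ := hstar (nb c v a) (hFF' f.2)
    refine ⟨g * k, mul_mem hg hk, ?_⟩
    have h1 : k v = nb c (nb c v a) b := by
      have h2 := map_nb c k (nb c v a) a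
      have h3 : (f : Equiv.Perm Ω) a = b := hf
      rwa [nb_nb, hkv, hkp, h3] at h2
    rw [RelIso.mul_apply, h1, hgw]

theorem mem_of_fixes_vertex [Finite Ω] (hΩ : 3 ≤ Nat.card Ω) (hT : T.IsTree)
    (c : LegalColoring T Ω)
    {F F' : Subgroup (Equiv.Perm Ω)} (hFF' : F ≤ F') (htrans : MulAction.IsPretransitive F Ω)
    {N : Subgroup (T ≃g T)} (hN : N ≠ ⊥)
    (hnorm : ∀ h ∈ G c F F' ⊓ typePreserving T, ∀ n ∈ N, h * n * h⁻¹ ∈ N)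
    (hstar : ∀ v, F' ≤ starAction c F N v) {g : T ≃g T} (hg : g ∈ G c F F') {v₀ : V}
    (hgv : g v₀ = v₀) : g ∈ N := by
  -- A singularity at `v₀` is not counted, since `mem_of_single` handles it at the end.
  obtain ⟨n, hn⟩ : ∃ n, ({v | localPerm c g v ∉ F} \ {v₀}).ncard = n := ⟨_, rfl⟩
  induction n generalizing g with
  | zero =>
    have hfin : ({v | localPerm c g v ∉ F} \ {v₀}).Finite := Set.Finite.sdiff hg.1
    rw [Set.ncard_eq_zero hfin] at hn
    refine mem_of_single hΩ hT c hFF' htrans hN hnorm (hstar v₀) hgv (hg.2 v₀) fun w hw => ?_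
    by_contra hcon
    have : w ∈ ({v | localPerm c g v ∉ F} \ {v₀}) := ⟨hcon, hw⟩
    rw [hn] at this
    exact this
  | succ n ih =>
    have hfin : ({v | localPerm c g v ∉ F} \ {v₀}).Finite := Set.Finite.sdiff hg.1
    obtain ⟨v, hv, hmax⟩ := Set.exists_max_image _ (fun v => T.dist v v₀) hfin
      (Set.nonempty_of_ncard_ne_zero (by omega))
    obtain ⟨a, ha⟩ := exists_mem_halfTree hT c (Ne.symm hv.2 : v₀ ≠ v)
    -- At the farthest singularity `v`, composing with `f` in `F` makes the local permutation fix
    -- the direction `a` of `v₀`. It then lifts to `k` in `N` fixing the side of `v₀`, and `g * k⁻¹`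
    -- has local permutation f⁻¹ at `v`.
    obtain ⟨f, hf⟩ := htrans.exists_smul_eq (localPerm c g v a) a
    have hf' : (f : Equiv.Perm Ω) (localPerm c g v a) = a := hf
    obtain ⟨k, hkv, hkX, hkp, hkF⟩ := exists_fixesOff_localPerm hT c htrans v
      (p := (f : Equiv.Perm Ω) * localPerm c g v) (a := a) hf'
    have hkp' : localPerm c k v ∈ F' := by
      rw [hkp]
      exact mul_mem (hFF' f.2) (hg.2 v)
    have hkN : k ∈ N := mem_of_single hΩ hT c hFF' htrans hN hnorm (hstar v) hkv hkp' hkF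
    have hkv₀ : k v₀ = v₀ := hkX v₀ (by rwa [← notMem_halfTree hT, not_not])
    have hS : {w | localPerm c (g * k⁻¹) w ∉ F} \ {v₀} =
        ({w | localPerm c g w ∉ F} \ {v₀}) \ {v} := by
      -- Vertices beyond `v` are farther from `v₀`, so by maximality `g` has no singularity there
      -- and `k⁻¹` creates none.
      have hbeyond : ∀ u ∈ halfTree c (nb c v a) a, u ≠ v → localPerm c g u ∈ F := by
        intro u hu huv
        by_contra hcon
        have hu₀ : u ≠ v₀ := by
          rintro rfl
          exact (notMem_halfTree hT c).2 hu ha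
        have h1 := hmax u ⟨hcon, hu₀⟩
        have h2 := dist_eq_add hT c ha ((notMem_halfTree hT c).2 hu)
        have h3 := hT.connected.pos_dist_of_ne huv
        omega
      have hkinv : k⁻¹ v = v := by rw [inv_apply_eq_iff, hkv]
      have hsame : ∀ w, w ≠ v → (localPerm c (g * k⁻¹) w ∉ F ↔ localPerm c g w ∉ F) := by
        intro w hw
        by_cases hwX : w ∈ halfTree c (nb c v a) a
        · have hkw : k⁻¹ w ≠ v := by rwa [Ne, inv_apply_eq_iff, hkv]
          refine not_congr (iff_of_true ?_ (hbeyond w hwX hw))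
          rw [localPerm_mul, localPerm_inv]
          exact mul_mem (hbeyond _ (hkX.inv.mem hwX) hkw) (inv_mem (hkF _ hkw))
        · rw [localPerm_mul, hkX.inv w hwX, hkX.inv.localPerm_eq_one hT c hwX, mul_one]
      ext w
      by_cases hw : w = v
      · subst hw
        refine iff_of_false (fun h => h.1 ?_) (fun h => h.2 rfl)
        rw [localPerm_mul, localPerm_inv, hkinv, hkp, mul_inv_rev, mul_inv_cancel_left]
        exact inv_mem f.2
      · simp only [Set.mem_sdiff, Set.mem_singleton_iff, hw, not_false_eq_true, and_true]
        exact and_congr_left fun _ => hsame w hw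
    have hmem : g * k⁻¹ ∈ N := by
      refine ih (mul_mem hg (inv_mem (mem_G_of_single c hFF' hkp' hkF))) ?_ ?_
      · rw [RelIso.mul_apply, (inv_apply_eq_iff k).2 hkv₀.symm, hgv]
      · rw [hS, Set.ncard_sdiff_singleton_of_mem hv, hn]
        rfl
    simpa using mul_mem hmem hkN

theorem le_of_normalized [Finite Ω] (hΩ : 3 ≤ Nat.card Ω) (hT : T.IsTree)
    (c : LegalColoring T Ω)
    {F F' : Subgroup (Equiv.Perm Ω)} (hFF' : F ≤ F') (htrans : MulAction.IsPretransitive F Ω)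
    (hgen : F' ≤ Subgroup.closure (⋃ a : Ω,
      ((⁅pointStabilizer F' a, pointStabilizer F' a⁆ : Subgroup (Equiv.Perm Ω)) :
        Set (Equiv.Perm Ω)) ∪ (pointStabilizer F a : Set (Equiv.Perm Ω))))
    {N : Subgroup (T ≃g T)} (hN : N ≠ ⊥) (hNG : N ≤ G c F F' ⊓ typePreserving T)
    (hnorm : ∀ h ∈ G c F F' ⊓ typePreserving T, ∀ n ∈ N, h * n * h⁻¹ ∈ N) :
    G c F F' ⊓ typePreserving T ≤ N := by
  have hstar := le_starAction hΩ hT c hFF' htrans hgen hN hnorm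
  intro g hg
  obtain ⟨v⟩ := hT.connected.nonempty
  obtain ⟨n, hn, hnv⟩ := exists_mem_map_eq hT c hFF' htrans hstar v (g v)
    ((mem_typePreserving_iff hT c g v).1 hg.2)
  have h1 : n⁻¹ * g ∈ N := by
    refine mem_of_fixes_vertex hΩ hT c hFF' htrans hN hnorm hstar (v₀ := v)
      ((G c F F').mul_mem ((G c F F').inv_mem (hNG hn).1) hg.1) ?_
    rw [RelIso.mul_apply, inv_apply_eq_iff, hnv]
  simpa using mul_mem hn h1

/-! ### Index two and simplicity -/

theorem index_typePreservingSubgroup (hT : T.IsTree) (c : LegalColoring T Ω) [Nonempty Ω]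
    {F F' : Subgroup (Equiv.Perm Ω)} (hFF' : F ≤ F') :
    (typePreservingSubgroup (G c F F')).index = 2 := by
  obtain ⟨v⟩ := hT.connected.nonempty
  let w := nb c v (Classical.arbitrary Ω)
  obtain ⟨t, htv, ht⟩ := exists_const_aut hT c 1 v w
  have htG : t ∈ G c F F' := U_le_G c hFF' fun u => by
    rw [ht]
    exact one_mem F
  rw [Subgroup.index_eq_two_iff]
  refine ⟨⟨t, htG⟩, fun g => ?_⟩
  -- Type preservation is tested at `v` for the product and at `w = t v` for `g`, so both tests
  -- concern the same image `g w`, seen from adjacent vertices.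
  have key : (g : T ≃g T) * t ∈ typePreserving T ↔ ¬ (g : T ≃g T) ∈ typePreserving T := by
    rw [mem_typePreserving_iff hT c _ v, mem_typePreserving_iff hT c _ w, RelIso.mul_apply, htv]
    rcases dist_nb hT c v ((g : T ≃g T) w) (Classical.arbitrary Ω) with h | h
    · change T.dist w _ = _ at h
      rw [h, Nat.even_add_one, not_not]
    · change _ = T.dist w _ + 1 at h
      rw [h, Nat.even_add_one]
  rw [xor_iff_iff_not]
  exact key

theorem isSimpleGroup_typePreservingSubgroup [Finite Ω] (hΩ : 3 ≤ Nat.card Ω) (hT : T.IsTree)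
    (c : LegalColoring T Ω)
    {F F' : Subgroup (Equiv.Perm Ω)} (hFF' : F ≤ F') (htrans : MulAction.IsPretransitive F Ω)
    (hgen : F' ≤ Subgroup.closure (⋃ a : Ω,
      ((⁅pointStabilizer F' a, pointStabilizer F' a⁆ : Subgroup (Equiv.Perm Ω)) :
        Set (Equiv.Perm Ω)) ∪ (pointStabilizer F a : Set (Equiv.Perm Ω)))) :
    IsSimpleGroup (typePreservingSubgroup (G c F F')) := by
  let ι : typePreservingSubgroup (G c F F') →* (T ≃g T) :=
    (G c F F').subtype.comp (typePreservingSubgroup (G c F F')).subtype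
  have hι : Function.Injective ι :=
    (G c F F').subtype_injective.comp (typePreservingSubgroup (G c F F')).subtype_injective
  have hlift : ∀ g ∈ G c F F' ⊓ typePreserving T, ∃ x, ι x = g := fun g hg =>
    ⟨⟨⟨g, hg.1⟩, hg.2⟩, rfl⟩
  have hmem : ∀ x, ι x ∈ G c F F' ⊓ typePreserving T := fun x => ⟨x.1.2, x.2⟩
  refine { exists_pair_ne := ?_, eq_bot_or_eq_top_of_normal := fun N hNn => ?_ }
  · obtain ⟨v⟩ := hT.connected.nonempty
    have : Nonempty Ω := (Nat.card_pos_iff.1 (by omega)).1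
    let a : Ω := Classical.arbitrary Ω
    obtain ⟨b, hb, -⟩ := exists_ne_ne hΩ a a
    -- Nontriviality: a colour-preserving automorphism moving `v` by distance two is
    -- type-preserving.
    obtain ⟨t, htv, ht⟩ := exists_const_aut hT c 1 v (nb c (nb c v a) b)
    have hd : T.dist v (nb c (nb c v a) b) = 2 := by
      have h1 := nb_halfTree_subset hT c hb (nb_mem_halfTree c (nb c v a) b)
      rw [mem_halfTree, SimpleGraph.dist_eq_one_iff_adj.2 (adj_nb c (nb c v a) b)] at h1
      exact h1
    obtain ⟨x, hx⟩ := hlift t ⟨U_le_G c hFF' fun u => by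
      rw [ht]
      exact one_mem F, (mem_typePreserving_iff hT c t v).2 (by rw [htv, hd]; exact even_two)⟩
    refine ⟨x, 1, ?_⟩
    rintro rfl
    have h2 : v = nb c (nb c v a) b := by rw [← htv, ← hx]; rfl
    rw [← h2] at hd
    simp at hd
  · refine or_iff_not_imp_left.2 fun hN => ?_
    have hle := le_of_normalized hΩ hT c hFF' htrans hgen (N := N.map ι)
      (fun h => hN ((Subgroup.map_eq_bot_iff_of_injective N hι).1 h))
      (by
        rintro _ ⟨x, -, rfl⟩
        exact hmem x)
      (by
        rintro h hh _ ⟨x, hx, rfl⟩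
        obtain ⟨y, rfl⟩ := hlift h hh
        exact ⟨y * x * y⁻¹, hNn.conj_mem x hx y, by simp⟩)
    refine eq_top_iff.2 fun x _ => ?_
    obtain ⟨y, hy, hxy⟩ := hle (hmem x)
    rwa [← hι hxy]

end TreeLocalAction

theorem mainTheorem1 {V Ω : Type*} [Finite Ω] (hΩ : 3 ≤ Nat.card Ω)
    (T : SimpleGraph V) (hT : T.IsTree) (c : TreeLocalAction.LegalColoring T Ω)
    (F F' : Subgroup (Equiv.Perm Ω)) (hFF' : F ≤ F')
    (htrans : MulAction.IsPretransitive F Ω)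
    (hgen : F' = Subgroup.closure (⋃ a : Ω,
      ((⁅TreeLocalAction.pointStabilizer F' a, TreeLocalAction.pointStabilizer F' a⁆ :
          Subgroup (Equiv.Perm Ω)) : Set (Equiv.Perm Ω)) ∪
        (TreeLocalAction.pointStabilizer F a : Set (Equiv.Perm Ω)))) :
    (TreeLocalAction.typePreservingSubgroup (TreeLocalAction.G c F F')).index = 2 ∧
      IsSimpleGroup (TreeLocalAction.typePreservingSubgroup (TreeLocalAction.G c F F')) := by
  have : Nonempty Ω := (Nat.card_pos_iff.1 (by omega)).1
  exact ⟨TreeLocalAction.index_typePreservingSubgroup hT c hFF',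
    TreeLocalAction.isSimpleGroup_typePreservingSubgroup hΩ hT c hFF' htrans hgen.le⟩
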